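/- Let $G=(V,E,\ell)$ be a compact metric graph: $(V,E)$ is a finite connected graph with at least one edge (loops and multiple edges are allowed), $\ell\colon E\to(0,\infty)$ assigns a length to each edge, and $G$ is the compact topological space obtained from the disjoint union of the intervals $[0,\ell(e)]$, $e\in E$, by gluing end points that correspond to the same vertex. Let $H^1(G)$ be the space of continuous functions $f\colon G\to\mathbb R$ whose restriction to every edge $e$ lies in $H^1((0,\ell(e)))$, and put $$q(f,g)=\int_G f'g'\,dx=\sum_{e\in E}\int_0^{\ell(e)} f_e'\,g_e'\,dx,\qquad q(f)=q(f,f).$$ For a Borel probability measure $\mu$ on $G$, let $H^1(G,\mu)$ be the space of all $f\in H^1(G)$ that are harmonic on $G\setminus\operatorname{supp}\mu$, i.e. such that $q(f,g)=0$ for every $g\in H^1(G)$ vanishing on $\operatorname{supp}\mu$. Viewing $H^1(G,\mu)$ as a subspace of $L^2(G,\mu)$, let $H_\mu$ be the non-negative self-adjoint operator in $L^2(G,\mu)$ defined by: $f\in\operatorname{dom}(H_\mu)$ and $H_\mu f=g$ if and only if $f\in H^1(G,\mu)$ and $q(f,\varphi)=\int_G g\varphi\,d\mu$ for all $\varphi\in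 H^1(G,\mu)$. Let $\lambda_0(H_\mu)<\lambda_1(H_\mu)\le\lambda_2(H_\mu)\le\cdots$ be its eigenvalues, counted with multiplicity, with $\lambda_k(H_\mu):=\infty$ if $k\ge\dim L^2(G,\mu)$, and define $$\lambda_1^{\min}(G):=\min_{\mu}\lambda_1(H_\mu),$$ the minimum being taken over all Borel probability measures $\mu$ on $G$. Then both this minimum and the minimum on the right-hand side below are attained, and $$\lambda_1^{\min}(G)=\min\Big\{q(f)\;:\; f\in H^1(G),\ \max_G f=1,\ \min_G f=-1\Big\}.$$ -/

import Mathlib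

open Set MeasureTheory
open scoped ContDiff

noncomputable section

/-- `g` is the distributional derivative of `u` on the open interval `(a, b)`, tested against
smooth functions with compact support in `(a, b)`. -/
def HasWeakDerivOn (a b : ℝ) (u g : ℝ → ℝ) : Prop :=
  ∀ φ : ℝ → ℝ, ContDiff ℝ ∞ φ → HasCompactSupport φ → tsupport φ ⊆ Ioo a b →
    ∫ x in Ioo a b, u x * deriv φ x = -∫ x in Ioo a b, g x * φ x

/-- The Sobolev space `H¹((a, b))`. -/
def MemH1Interval (a b : ℝ) (u : ℝ → ℝ) : Prop :=
  MemLp u 2 (volume.restrict (Ioo a b)) ∧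
    ∃ g : ℝ → ℝ, MemLp g 2 (volume.restrict (Ioo a b)) ∧ HasWeakDerivOn a b u g

open Classical in
/-- The weak derivative of `u ∈ H¹((a, b))` (a representative, unique up to a null set of
`(a, b)`); the value `0` for other functions is never used. -/
def weakDeriv (a b : ℝ) (u : ℝ → ℝ) : ℝ → ℝ :=
  if h : ∃ g : ℝ → ℝ, MemLp g 2 (volume.restrict (Ioo a b)) ∧ HasWeakDerivOn a b u g then
    h.choose
  else 0

/-- A connected graph (loops and multiple edges are allowed) with vertices `V` and edges `E`,
an orientation of its edges, and positive finite edge lengths. -/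
structure MetricGraph (V E : Type*) where
  source : E → V
  target : E → V
  length : E → ℝ
  length_pos : ∀ e, 0 < length e
  connected : ∀ u v : V, Relation.EqvGen (fun a b => ∃ e, source e = a ∧ target e = b) u v

namespace MetricGraph

variable {V E : Type*} (G : MetricGraph V E)

/-- The disjoint union of the closed intervals `[0, ℓ(e)]`, `e ∈ E`. -/
abbrev PrePoint : Type _ := Σ e : E, Icc (0 : ℝ) (G.length e)

/-- `p` is the end point of its interval that corresponds to the vertex `v`. -/
def IsEndAt (p : G.PrePoint) (v : V) : Prop :=
  ((p.2 : ℝ) = 0 ∧ G.source p.1 = v) ∨ ((p.2 : ℝ) = G.length p.1 ∧ G.target p.1 = v)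

/-- Two end points of intervals are glued if they correspond to the same vertex. -/
def Glue (p p' : G.PrePoint) : Prop := ∃ v : V, G.IsEndAt p v ∧ G.IsEndAt p' v

/-- The metric realization of the graph: the intervals `[0, ℓ(e)]`, glued at the end points that
correspond to the same vertex. -/
def Point : Type _ := Quot G.Glue

/-- The quotient topology. -/
instance : TopologicalSpace G.Point := inferInstanceAs (TopologicalSpace (Quot G.Glue))

instance : MeasurableSpace G.Point := borel G.Point

instance : BorelSpace G.Point := ⟨rfl⟩

/-- The point with coordinate `t ∈ [0, ℓ(e)]` on the edge `e`. -/
def edgePoint (e : E) (t : Icc (0 : ℝ) (G.length e)) : G.Point := Quot.mk G.Glue ⟨e, t⟩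

/-- The restriction of `f` to the edge `e` as a function of the coordinate in `[0, ℓ(e)]`
(continued by constants outside of this interval). -/
def onEdge (f : G.Point → ℝ) (e : E) : ℝ → ℝ :=
  IccExtend (G.length_pos e).le fun t => f (G.edgePoint e t)

/-- The Sobolev space `H¹(G)`. -/
def MemH1 (f : G.Point → ℝ) : Prop :=
  Continuous f ∧ ∀ e, MemH1Interval 0 (G.length e) (G.onEdge f e)

/-- The energy form `q(f, g) = ∫_G f' g' dx` on `H¹(G)`. -/
def energyForm [Fintype E] (f g : G.Point → ℝ) : ℝ :=
  ∑ e, ∫ t in Ioo 0 (G.length e),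
    weakDeriv 0 (G.length e) (G.onEdge f e) t * weakDeriv 0 (G.length e) (G.onEdge g e) t

/-- The energy `q(f) = ∫_G |f'|² dx`. -/
def energy [Fintype E] (f : G.Point → ℝ) : ℝ := G.energyForm f f

/-- `f ∈ H¹(G)` is harmonic on the open set `O`. -/
def IsHarmonicOn [Fintype E] (f : G.Point → ℝ) (O : Set G.Point) : Prop :=
  ∀ g : G.Point → ℝ, G.MemH1 g → (∀ x ∉ O, g x = 0) → G.energyForm f g = 0

/-- The space `H¹(G, μ)` of the functions in `H¹(G)` that are harmonic outside of the support
of `μ`. -/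
def MemH1Measure [Fintype E] (μ : Measure G.Point) (f : G.Point → ℝ) : Prop :=
  G.MemH1 f ∧ G.IsHarmonicOn f μ.supportᶜ

/-- The graph of the Laplacian `H_μ`, the self-adjoint operator of the form `q` on `H¹(G, μ)` in
the Hilbert space `L²(G, μ)`: this says that `u ∈ dom(H_μ)` and `H_μ u = w`. -/
def LaplacianRel [Fintype E] (μ : Measure G.Point) (u w : Lp ℝ 2 μ) : Prop :=
  ∃ f : G.Point → ℝ, G.MemH1Measure μ f ∧ u =ᵐ[μ] f ∧
    ∀ φ : G.Point → ℝ, G.MemH1Measure μ φ → G.energyForm f φ = ∫ x, w x * φ x ∂μ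

/-- The span in `L²(G, μ)` of all eigenvectors of `H_μ` for eigenvalues `s ≤ c`. Its dimension is
the number of eigenvalues `≤ c`, counted with multiplicity. -/
def spectralSubspace [Fintype E] (μ : Measure G.Point) (c : ℝ) : Submodule ℝ (Lp ℝ 2 μ) :=
  Submodule.span ℝ {u | ∃ s ≤ c, G.LaplacianRel μ u (s • u)}

/-- The eigenvalue `λ_k(H_μ)`, `k = 0, 1, 2, …`, where the eigenvalues are enumerated
increasingly and with multiplicity: the least `c` such that at least `k + 1` eigenvalues are
`≤ c`. It is `∞` if `H_μ` has at most `k` eigenvalues. -/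
def eigenvalue [Fintype E] (μ : Measure G.Point) (k : ℕ) : EReal :=
  sInf {x : EReal | ∃ c : ℝ, x = (c : EReal) ∧
    ((k + 1 : ℕ) : Cardinal) ≤ Module.rank ℝ (G.spectralSubspace μ c)}

/-- The optimal eigenvalue `λ_k^min(G)`, the infimum of `λ_k(H_μ)` over all Borel probability
measures `μ` on `G`. -/
def optimalEigenvalue [Fintype E] (k : ℕ) : EReal :=
  sInf {x : EReal | ∃ μ : Measure G.Point, IsProbabilityMeasure μ ∧ x = G.eigenvalue μ k}

end MetricGraph

end

/-! Taking derivatives turns `H¹(G)` modulo constants into a closed subspace `derivs` of an `L²`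
space, with `q` as the inner product. The functional `f ↦ f x - f y` is represented there by a
kernel `k`, and `‖k‖ ^ 2` is the effective resistance between `x` and `y`. By compactness some pair
`x`, `y` maximizes it (`exists_maximal_kernel`). For this pair, Cauchy-Schwarz bounds the
oscillation of every `φ` by `‖k‖` times the root of its energy, so a function attaining `1` and `-1`
has energy at least `m = 4 / ‖k‖ ^ 2`. The rescaled primitive `f` of `k` attains this bound, with
its maximum at `x` and its minimum at `y` (`exists_optimal_potential`). For `μ = (δ_x + δ_y) / 2`,
this `f` is an eigenfunction with eigenvalue `m` (`exists_two_le_rank_spectralSubspace`).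
Conversely, for any `μ` a nonconstant eigenfunction has mean zero; shifting its range to `[-M, M]`
gives `∫ f² dμ ≤ M²`, so its Rayleigh quotient is at least `m`
(`le_of_two_le_rank_spectralSubspace`). -/

/-! ### Weak derivatives on an interval. -/

theorem exists_Icc_of_isCompact_subset_Ioo {a b : ℝ} (hab : a < b) {K : Set ℝ} (hK : IsCompact K)
    (hKs : K ⊆ Ioo a b) : ∃ c d, a < c ∧ d < b ∧ c ≤ d ∧ K ⊆ Icc c d := by
  have hm : (a + b) / 2 ∈ Ioo a b := ⟨by linarith, by linarith⟩
  -- The midpoint keeps the set nonempty when `K` is empty.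
  have hK' : IsCompact (insert ((a + b) / 2) K) := hK.insert _
  have hs : insert ((a + b) / 2) K ⊆ Ioo a b := insert_subset hm hKs
  obtain ⟨c, hc⟩ := hK'.exists_isLeast ⟨_, mem_insert _ _⟩
  obtain ⟨d, hd⟩ := hK'.exists_isGreatest ⟨_, mem_insert _ _⟩
  exact ⟨c, d, (hs hc.1).1, (hs hd.1).2, hc.2 hd.1,
    fun x hx => ⟨hc.2 (mem_insert_of_mem _ hx), hd.2 (mem_insert_of_mem _ hx)⟩⟩

/-- A test function on `(a, b)` with vanishing integral is the derivative of a test function. -/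
theorem exists_testFunction_deriv_eq {a b : ℝ} (hab : a < b) {θ : ℝ → ℝ} (hθ : ContDiff ℝ ∞ θ)
    (hc : HasCompactSupport θ) (hs : tsupport θ ⊆ Ioo a b) (h0 : ∫ x, θ x = 0) :
    ∃ φ : ℝ → ℝ, ContDiff ℝ ∞ φ ∧ HasCompactSupport φ ∧ tsupport φ ⊆ Ioo a b ∧ deriv φ = θ := by
  obtain ⟨c, d, hac, hdb, -, hK⟩ := exists_Icc_of_isCompact_subset_Ioo hab hc hs
  have hz : ∀ x, x ∉ Icc c d → θ x = 0 := fun x hx => by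
    by_contra hne
    exact hx (hK (subset_tsupport _ hne))
  have hd : ∀ x, HasDerivAt (fun x => ∫ t in a..x, θ t) (θ x) x := fun x =>
    intervalIntegral.integral_hasDerivAt_right (hθ.continuous.intervalIntegrable _ _)
      (hθ.continuous.stronglyMeasurableAtFilter _ _) hθ.continuous.continuousAt
  have hd' : deriv (fun x => ∫ t in a..x, θ t) = θ := funext fun x => (hd x).deriv
  have hsupp : Function.support (fun x => ∫ t in a..x, θ t) ⊆ Icc c d := by
    intro x hx
    by_contra hxn
    apply hx
    rcases lt_or_ge x c with hxc | hxc
    · refine intervalIntegral.integral_zero_ae (Filter.Eventually.of_forall fun t ht => hz t ?_)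
      intro h
      rw [mem_uIoc] at ht
      rcases ht with ht | ht <;> linarith [h.1, ht.2]
    · have hxd : d < x := by
        by_contra h
        exact hxn ⟨hxc, not_lt.1 h⟩
      rw [← h0]
      refine intervalIntegral.integral_eq_integral_of_support_subset fun t ht => ?_
      have := hK (subset_tsupport _ ht)
      exact ⟨hac.trans_le this.1, this.2.trans hxd.le⟩
  have ht : tsupport (fun x => ∫ t in a..x, θ t) ⊆ Icc c d := closure_minimal hsupp isClosed_Icc
  refine ⟨fun x => ∫ t in a..x, θ t, ?_, ?_, ?_, hd'⟩
  · rw [contDiff_infty_iff_deriv, hd']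
    exact ⟨fun x => (hd x).differentiableAt, hθ⟩
  · exact HasCompactSupport.of_support_subset_isCompact isCompact_Icc hsupp
  · exact ht.trans (Icc_subset_Ioo hac hdb)

theorem exists_testFunction_integral_eq_one {a b : ℝ} (hab : a < b) :
    ∃ η : ℝ → ℝ, ContDiff ℝ ∞ η ∧ HasCompactSupport η ∧ tsupport η ⊆ Ioo a b ∧ ∫ x, η x = 1 := by
  let B : ContDiffBump ((a + b) / 2) :=
    ⟨(b - a) / 8, (b - a) / 4, by linarith, by linarith⟩
  refine ⟨B.normed volume, B.contDiff_normed, B.hasCompactSupport_normed, ?_, B.integral_normed⟩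
  rw [B.tsupport_normed_eq, Real.closedBall_eq_Icc]
  refine Icc_subset_Ioo ?_ ?_ <;> simp only [B] <;> linarith

/-- The lemma of du Bois-Reymond. -/
theorem eq_left_of_integral_mul_deriv_eq_zero {a b : ℝ} (hab : a < b) {w : ℝ → ℝ}
    (hw : ContinuousOn w (Icc a b))
    (h : ∀ φ : ℝ → ℝ, ContDiff ℝ ∞ φ → HasCompactSupport φ → tsupport φ ⊆ Ioo a b →
      ∫ x in Ioo a b, w x * deriv φ x = 0) : ∀ t ∈ Icc a b, w t = w a := by
  obtain ⟨η, hη, hηc, hηs, hη1⟩ := exists_testFunction_integral_eq_one hab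
  have hwi : IntegrableOn w (Icc a b) := hw.integrableOn_Icc
  have hmul : ∀ ψ : ℝ → ℝ, Continuous ψ → IntegrableOn (fun x => w x * ψ x) (Ioo a b) :=
    fun ψ hψ => ((hw.mul hψ.continuousOn).integrableOn_Icc).mono_set Ioo_subset_Icc_self
  have hall : ∀ ψ : ℝ → ℝ, tsupport ψ ⊆ Ioo a b → ∫ x in Ioo a b, ψ x = ∫ x, ψ x :=
    fun ψ hψ => setIntegral_eq_integral_of_forall_compl_eq_zero fun x hx => by
      by_contra hne
      exact hx (hψ (subset_tsupport _ hne))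
  set c := ∫ x in Ioo a b, w x * η x with hc
  have key : ∀ᵐ x, x ∈ Ioo a b → w x - c = 0 := by
    refine isOpen_Ioo.ae_eq_zero_of_integral_contDiff_smul_eq_zero
      (((hwi.mono_set Ioo_subset_Icc_self).sub
        (integrableOn_const (by simp))).locallyIntegrableOn) ?_
    intro ψ hψ hψc hψs
    -- Subtracting a multiple of `η` makes the integral of `ψ` vanish, so the difference is an
    -- admissible `deriv φ`.
    have hθs : tsupport (fun x => ψ x - (∫ y, ψ y) * η x) ⊆ Ioo a b := by
      refine (tsupport_sub ψ _).trans (union_subset hψs ?_)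
      exact (tsupport_mul_subset_right).trans hηs
    obtain ⟨φ, hφ, hφc, hφs, hφd⟩ := exists_testFunction_deriv_eq hab
      (θ := fun x => ψ x - (∫ y, ψ y) * η x) (by fun_prop)
      (hψc.sub (hηc.mul_left)) hθs (by
        rw [integral_sub (hψ.continuous.integrable_of_hasCompactSupport hψc)
          ((hη.continuous.integrable_of_hasCompactSupport hηc).const_mul _),
          integral_const_mul, hη1]
        ring)
    have h1 := h φ hφ hφc hφs
    rw [hφd] at h1
    have h2 : ∫ x in Ioo a b, w x * (ψ x - (∫ y, ψ y) * η x) =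
        (∫ x in Ioo a b, w x * ψ x) - (∫ y, ψ y) * c := by
      rw [hc, ← integral_const_mul, ← integral_sub (hmul ψ hψ.continuous)
        ((hmul η hη.continuous).const_mul _)]
      exact integral_congr_ae (Filter.Eventually.of_forall fun x => by ring)
    have h3 : ∫ x, ψ x • (w x - c) = ∫ x in Ioo a b, ψ x • (w x - c) := by
      refine (setIntegral_eq_integral_of_forall_compl_eq_zero fun x hx => ?_).symm
      have : ψ x = 0 := by
        by_contra hne
        exact hx (hψs (subset_tsupport _ hne))
      simp [this]
    have h4 : ∫ x in Ioo a b, ψ x • (w x - c) =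
        (∫ x in Ioo a b, w x * ψ x) - (∫ x in Ioo a b, ψ x) * c := by
      rw [← integral_mul_const, ← integral_sub (hmul ψ hψ.continuous)
        ((hψ.continuous.integrable_of_hasCompactSupport hψc).integrableOn.mul_const _)]
      exact integral_congr_ae (Filter.Eventually.of_forall fun x => by simp; ring)
    rw [h3, h4, hall ψ hψs, ← h2, h1]
  have hE : EqOn w (fun _ => c) (Icc a b) := by
    refine Measure.eqOn_Icc_of_ae_eq volume hab.ne ?_ hw continuousOn_const
    rw [← restrict_Ioo_eq_restrict_Icc, Filter.EventuallyEq, ae_restrict_iff' measurableSet_Ioo]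
    filter_upwards [key] with x hx hx'
    linarith [hx hx']
  intro t ht
  rw [hE ht, hE (left_mem_Icc.2 hab.le)]

/-- A primitive of an integrable function has it as weak derivative. -/
theorem hasWeakDerivOn_of_eq_integral {a b : ℝ} (hab : a < b) {u g : ℝ → ℝ}
    (hg : IntegrableOn g (Ioo a b)) (hu : ∀ t ∈ Icc a b, u t = u a + ∫ x in a..t, g x) :
    HasWeakDerivOn a b u g := by
  intro φ hφ hφc hφs
  have hgi : IntervalIntegrable g volume a b := by
    rwa [intervalIntegrable_iff_integrableOn_Ioo_of_le hab.le]
  have hz : ∀ x, x ∉ Ioo a b → φ x = 0 := fun x hx => by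
    by_contra hne
    exact hx (hφs (subset_tsupport _ hne))
  have hI : AbsolutelyContinuousOnInterval (fun t => ∫ x in a..t, g x) a b :=
    hgi.absolutelyContinuousOnInterval_intervalIntegral left_mem_uIcc
  have hC : AbsolutelyContinuousOnInterval (fun _ : ℝ => u a) a b :=
    (contDiffOn_const (n := 1)).absolutelyContinuousOnInterval
  have hU : AbsolutelyContinuousOnInterval (fun t => u a + ∫ x in a..t, g x) a b := hC.add hI
  have hΦ : AbsolutelyContinuousOnInterval φ a b :=
    (hφ.of_le (by simp)).contDiffOn.absolutelyContinuousOnInterval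
  -- Integration by parts for absolutely continuous functions; the boundary terms vanish with `φ`.
  have key := hU.integral_mul_deriv_eq_deriv_mul hΦ
  rw [hz a (by simp), hz b (by simp)] at key
  rw [← integral_Ioc_eq_integral_Ioo, ← integral_Ioc_eq_integral_Ioo,
    ← intervalIntegral.integral_of_le hab.le, ← intervalIntegral.integral_of_le hab.le]
  have e1 : ∫ x in a..b, u x * deriv φ x =
      ∫ x in a..b, (u a + ∫ y in a..x, g y) * deriv φ x := by
    refine intervalIntegral.integral_congr fun x hx => ?_
    rw [uIcc_of_le hab.le] at hx
    simp only [hu x hx]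
  have e2 : ∫ x in a..b, deriv (fun t => u a + ∫ y in a..t, g y) x * φ x =
      ∫ x in a..b, g x * φ x := by
    refine intervalIntegral.integral_congr_ae ?_
    filter_upwards [hgi.ae_hasDerivAt_integral] with x hx hx'
    rw [((hx (uIoc_subset_uIcc hx') a left_mem_uIcc).const_add (u a)).deriv]
  rw [e1, key, e2]
  ring

theorem HasWeakDerivOn.ae_eq {a b : ℝ} {u g g' : ℝ → ℝ} (hg : IntegrableOn g (Ioo a b))
    (hg' : IntegrableOn g' (Ioo a b)) (h : HasWeakDerivOn a b u g)
    (h' : HasWeakDerivOn a b u g') : g =ᵐ[volume.restrict (Ioo a b)] g' := by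
  have key : ∀ᵐ x, x ∈ Ioo a b → g x - g' x = 0 := by
    refine isOpen_Ioo.ae_eq_zero_of_integral_contDiff_smul_eq_zero
      (hg.sub hg').locallyIntegrableOn ?_
    intro ψ hψ hψc hψs
    have hmul : ∀ f : ℝ → ℝ, IntegrableOn f (Ioo a b) →
        IntegrableOn (fun x => f x * ψ x) (Ioo a b) := fun f hf => by
      obtain ⟨C, hC⟩ := hψc.exists_bound_of_continuous hψ.continuous
      exact hf.mul_bdd hψ.continuous.aestronglyMeasurable (Filter.Eventually.of_forall hC)
    have h3 : ∫ x, ψ x • (g x - g' x) = ∫ x in Ioo a b, (g x * ψ x - g' x * ψ x) := by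
      rw [← setIntegral_eq_integral_of_forall_compl_eq_zero (s := Ioo a b)]
      · exact integral_congr_ae (Filter.Eventually.of_forall fun x => by simp; ring)
      · intro x hx
        have : ψ x = 0 := by
          by_contra hne
          exact hx (hψs (subset_tsupport _ hne))
        simp [this]
    rw [h3, integral_sub (hmul g hg) (hmul g' hg')]
    have := h ψ hψ hψc hψs
    have := h' ψ hψ hψc hψs
    linarith
  rw [Filter.EventuallyEq, ae_restrict_iff' measurableSet_Ioo]
  filter_upwards [key] with x hx hx'
  linarith [hx hx']

/-- A continuous function with an integrable weak derivative is its primitive. -/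
theorem HasWeakDerivOn.eq_integral {a b : ℝ} (hab : a < b) {u g : ℝ → ℝ}
    (hu : ContinuousOn u (Icc a b)) (hg : IntegrableOn g (Ioo a b))
    (h : HasWeakDerivOn a b u g) : ∀ t ∈ Icc a b, u t = u a + ∫ x in a..t, g x := by
  have hgI : IntegrableOn g (Icc a b) := by
    rwa [IntegrableOn, ← restrict_Ioo_eq_restrict_Icc]
  have hP : ContinuousOn (fun t => ∫ x in a..t, g x) (Icc a b) :=
    intervalIntegral.continuousOn_primitive_interval (by rwa [uIcc_of_le hab.le]) |>.mono
      (by rw [uIcc_of_le hab.le])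
  have h0 := hasWeakDerivOn_of_eq_integral (u := fun t => ∫ x in a..t, g x) hab hg
    (fun t _ => by simp)
  have hi : ∀ f : ℝ → ℝ, ContinuousOn f (Icc a b) → ∀ φ : ℝ → ℝ, ContDiff ℝ ∞ φ →
      IntegrableOn (fun x => f x * deriv φ x) (Ioo a b) := fun f hf φ hφ =>
    (hf.mul (hφ.continuous_deriv (by simp)).continuousOn).integrableOn_Icc.mono_set
      Ioo_subset_Icc_self
  have := eq_left_of_integral_mul_deriv_eq_zero hab (hu.sub hP) (fun φ hφ hφc hφs => by
    have e : ∀ x, (u x - ∫ y in a..x, g y) * deriv φ x =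
      u x * deriv φ x - (∫ y in a..x, g y) * deriv φ x := fun x => by ring
    simp only [Pi.sub_apply, e]
    rw [integral_sub (hi u hu φ hφ) (hi _ hP φ hφ), h φ hφ hφc hφs, h0 φ hφ hφc hφs, sub_self])
  intro t ht
  have := this t ht
  simp at this
  linarith

/-! ### `H¹(G)` described by derivatives in a Hilbert space. -/

namespace MetricGraph

variable {V E : Type*} (G : MetricGraph V E)

/-- The Hilbert space containing the derivatives of the functions in `H¹(G)`. -/
abbrev DerivSpace : Type _ :=
  PiLp 2 fun e : E => Lp ℝ 2 (volume.restrict (Ioo 0 (G.length e)))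

/-- The indicator function of `(0, t]` on the edge `e`. -/
noncomputable def segment (e : E) (t : ℝ) : Lp ℝ 2 (volume.restrict (Ioo 0 (G.length e))) :=
  indicatorConstLp 2 (measurableSet_Ioc (a := 0) (b := t)) (measure_ne_top _ _) 1

/-- The initial point of an edge. -/
abbrev edgeStart (e : E) : Icc (0 : ℝ) (G.length e) := ⟨0, left_mem_Icc.2 (G.length_pos e).le⟩

/-- The final point of an edge. -/
abbrev edgeEnd (e : E) : Icc (0 : ℝ) (G.length e) :=
  ⟨G.length e, right_mem_Icc.2 (G.length_pos e).le⟩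

/-- On every edge, `f` is a primitive of `g`. -/
def IsPrimitive (f : G.Point → ℝ) (g : G.DerivSpace) : Prop :=
  ∀ e (t : Icc (0 : ℝ) (G.length e)),
    f (G.edgePoint e t) = f (G.edgePoint e (G.edgeStart e)) + inner ℝ (G.segment e t) (g e)

theorem inner_segment (e : E) {t : ℝ} (ht : t ∈ Icc 0 (G.length e))
    (g : Lp ℝ 2 (volume.restrict (Ioo 0 (G.length e)))) :
    inner ℝ (G.segment e t) g = ∫ x in (0 : ℝ)..t, g x := by
  have hr : (volume.restrict (Ioo 0 (G.length e))).restrict (Ioc 0 t) =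
      volume.restrict (Ioc 0 t) := by
    rw [restrict_Ioo_eq_restrict_Ioc, Measure.restrict_restrict measurableSet_Ioc, Ioc_inter_Ioc]
    simp [ht.2]
  rw [segment, L2.inner_indicatorConstLp_one, intervalIntegral.integral_of_le ht.1, hr]

theorem segment_zero (e : E) : G.segment e 0 = 0 := by
  simp [segment]

theorem inner_segment_segment (e : E) {s t : ℝ} (hs : s ∈ Icc 0 (G.length e))
    (ht : t ∈ Icc 0 (G.length e)) :
    inner ℝ (G.segment e s) (G.segment e t) = min s t := by
  have hm : (volume.restrict (Ioo 0 (G.length e))).real (Ioc 0 (min s t)) = min s t := by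
    rw [restrict_Ioo_eq_restrict_Ioc, measureReal_restrict_apply measurableSet_Ioc,
      Ioc_inter_Ioc]
    simp [hs.1, hs.2, ht.1]
  simp only [segment, L2.inner_indicatorConstLp_indicatorConstLp, Ioc_inter_Ioc, max_self, hm]
  simp

/-- Source of the Hölder-1/2 estimate behind the continuity of the kernels. -/
theorem norm_segment_sub_sq (e : E) {s t : ℝ} (hs : s ∈ Icc 0 (G.length e))
    (ht : t ∈ Icc 0 (G.length e)) : ‖G.segment e t - G.segment e s‖ ^ 2 = |t - s| := by
  rw [@norm_sub_sq_real, ← real_inner_self_eq_norm_sq, ← real_inner_self_eq_norm_sq,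
    G.inner_segment_segment e ht hs, G.inner_segment_segment e ht ht,
    G.inner_segment_segment e hs hs]
  rcases le_total s t with h | h
  · rw [min_eq_right h, abs_of_nonneg (by linarith), min_self, min_self]; ring
  · rw [min_eq_left h, abs_of_nonpos (by linarith), min_self, min_self]; ring

variable {G}

theorem IsPrimitive.add {f₁ f₂ : G.Point → ℝ} {g₁ g₂ : G.DerivSpace} (h₁ : G.IsPrimitive f₁ g₁)
    (h₂ : G.IsPrimitive f₂ g₂) : G.IsPrimitive (f₁ + f₂) (g₁ + g₂) := fun e t => by
  simp only [Pi.add_apply, PiLp.add_apply, inner_add_right, h₁ e t, h₂ e t]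
  ring

theorem IsPrimitive.smul {f : G.Point → ℝ} {g : G.DerivSpace} (h : G.IsPrimitive f g) (c : ℝ) :
    G.IsPrimitive (c • f) (c • g) := fun e t => by
  simp only [Pi.smul_apply, PiLp.smul_apply, inner_smul_right, smul_eq_mul, h e t]
  ring

theorem isPrimitive_const (c : ℝ) : G.IsPrimitive (fun _ => c) 0 := fun e t => by
  simp

theorem integrableOn_derivSpace (g : G.DerivSpace) (e : E) :
    IntegrableOn (g e) (Ioo 0 (G.length e)) :=
  (Lp.memLp (g e)).integrable (by norm_num)

theorem onEdge_coe (f : G.Point → ℝ) (e : E) {t : ℝ} (ht : t ∈ Icc 0 (G.length e)) :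
    G.onEdge f e t = f (G.edgePoint e ⟨t, ht⟩) :=
  IccExtend_of_mem _ _ ht

theorem isPrimitive_iff {f : G.Point → ℝ} {g : G.DerivSpace} :
    G.IsPrimitive f g ↔ ∀ e, ∀ t ∈ Icc 0 (G.length e),
      G.onEdge f e t = G.onEdge f e 0 + ∫ x in (0 : ℝ)..t, g e x := by
  refine forall_congr' fun e => ⟨fun h t ht => ?_, fun h t => ?_⟩
  · rw [onEdge_coe f e ht, onEdge_coe f e (G.edgeStart e).2, ← G.inner_segment e ht]
    exact h ⟨t, ht⟩
  · have := h t t.2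
    rwa [onEdge_coe f e t.2, onEdge_coe f e (G.edgeStart e).2, ← G.inner_segment e t.2] at this

theorem continuous_point_iff {X : Type*} [TopologicalSpace X] {f : G.Point → X} :
    Continuous f ↔ ∀ e, Continuous fun t => f (G.edgePoint e t) := by
  have hq : Topology.IsQuotientMap (Quot.mk G.Glue : G.PrePoint → G.Point) :=
    isQuotientMap_quot_mk
  exact hq.continuous_iff.trans continuous_sigma_iff

theorem IsPrimitive.continuous {f : G.Point → ℝ} {g : G.DerivSpace} (h : G.IsPrimitive f g) :
    Continuous f := by
  refine continuous_point_iff.2 fun e => ?_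
  have hP : ContinuousOn (fun t => G.onEdge f e t) (Icc 0 (G.length e)) := by
    refine ContinuousOn.congr ?_ (isPrimitive_iff.1 h e)
    refine continuousOn_const.add ?_
    have := intervalIntegral.continuousOn_primitive_interval (μ := volume) (f := g e) (a := 0)
      (b := G.length e) (by
        rw [uIcc_of_le (G.length_pos e).le, IntegrableOn, ← restrict_Ioo_eq_restrict_Icc]
        exact integrableOn_derivSpace g e)
    rwa [uIcc_of_le (G.length_pos e).le] at this
  rw [continuousOn_iff_continuous_domRestrict] at hP
  refine hP.congr fun t => ?_
  exact onEdge_coe f e t.2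

theorem IsPrimitive.hasWeakDerivOn {f : G.Point → ℝ} {g : G.DerivSpace} (h : G.IsPrimitive f g)
    (e : E) : HasWeakDerivOn 0 (G.length e) (G.onEdge f e) (g e) :=
  hasWeakDerivOn_of_eq_integral (G.length_pos e) (integrableOn_derivSpace g e)
    (isPrimitive_iff.1 h e)

theorem continuous_onEdge {f : G.Point → ℝ} (h : Continuous f) (e : E) :
    Continuous (G.onEdge f e) :=
  (continuous_point_iff.1 h e).Icc_extend'

theorem IsPrimitive.memH1 {f : G.Point → ℝ} {g : G.DerivSpace} (h : G.IsPrimitive f g) :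
    G.MemH1 f := by
  refine ⟨h.continuous, fun e => ⟨?_, g e, Lp.memLp (g e), h.hasWeakDerivOn e⟩⟩
  obtain ⟨C, hC⟩ := isCompact_Icc.exists_bound_of_continuousOn
    (continuous_onEdge h.continuous e).continuousOn (s := Icc 0 (G.length e))
  refine MemLp.of_bound (continuous_onEdge h.continuous e).aestronglyMeasurable C ?_
  filter_upwards [ae_restrict_mem measurableSet_Ioo] with t ht
  exact hC t (Ioo_subset_Icc_self ht)

theorem MemH1.exists_isPrimitive {f : G.Point → ℝ} (h : G.MemH1 f) :
    ∃ g, G.IsPrimitive f g := by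
  choose g hg hfg using fun e => (h.2 e).2
  refine ⟨WithLp.toLp 2 fun e => (hg e).toLp (g e), isPrimitive_iff.2 fun e => ?_⟩
  have hae : (hg e).toLp (g e) =ᵐ[volume.restrict (Ioo 0 (G.length e))] g e :=
    (hg e).coeFn_toLp
  refine HasWeakDerivOn.eq_integral (G.length_pos e) (continuous_onEdge h.1 e).continuousOn
    ((Lp.memLp _).integrable (by norm_num)) ?_
  intro φ h1 h2 h3
  rw [hfg e φ h1 h2 h3]
  congr 1
  exact integral_congr_ae (by filter_upwards [hae] with x hx; simp only [hx])

/-- Uniqueness of weak derivatives makes the choice in `weakDeriv` harmless, so energies can be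
computed from any primitive relation. -/
theorem IsPrimitive.weakDeriv_ae_eq {f : G.Point → ℝ} {g : G.DerivSpace}
    (h : G.IsPrimitive f g) (e : E) :
    weakDeriv 0 (G.length e) (G.onEdge f e) =ᵐ[volume.restrict (Ioo 0 (G.length e))] g e := by
  have hex := (h.memH1.2 e).2
  rw [weakDeriv, dif_pos hex]
  exact HasWeakDerivOn.ae_eq (hex.choose_spec.1.integrable (by norm_num))
    (integrableOn_derivSpace g e) hex.choose_spec.2 (h.hasWeakDerivOn e)

variable (G) in
/-- The increments of the primitives along the edges. -/
noncomputable def increment : G.DerivSpace →L[ℝ] E → ℝ :=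
  ContinuousLinearMap.pi fun e => (innerSL ℝ (G.segment e (G.length e))).comp (PiLp.proj 2 _ e)

theorem increment_apply (g : G.DerivSpace) (e : E) :
    G.increment g e = inner ℝ (G.segment e (G.length e)) (g e) := rfl

variable (G) in
/-- The coboundary map of the graph. -/
def coboundary : (V → ℝ) →ₗ[ℝ] E → ℝ where
  toFun p e := p (G.target e) - p (G.source e)
  map_add' p p' := by ext; simp; ring
  map_smul' c p := by ext; simp; ring

variable (G) in
/-- The derivatives of the functions in `H¹(G)`. -/
noncomputable def derivs : Submodule ℝ G.DerivSpace :=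
  (LinearMap.range G.coboundary).comap G.increment.toLinearMap

/-- Integrating `g` from the vertex value at the source of each edge respects the gluing exactly
because the increments are differences of vertex values. -/
theorem exists_isPrimitive_of_mem_derivs {g : G.DerivSpace} (hg : g ∈ G.derivs) :
    ∃ f, G.IsPrimitive f g := by
  obtain ⟨p, hp⟩ := hg
  let F : G.PrePoint → ℝ := fun q => p (G.source q.1) + inner ℝ (G.segment q.1 q.2) (g q.1)
  have hF : ∀ q v, G.IsEndAt q v → F q = p v := by
    rintro q v (⟨h0, rfl⟩ | ⟨h1, rfl⟩)
    · simp [F, h0, segment_zero]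
    · have : p (G.target q.1) - p (G.source q.1) = _ := congrFun hp q.1
      simp only [F, h1]
      rw [ContinuousLinearMap.coe_coe, increment_apply] at this
      linarith
  refine ⟨Quot.lift F fun q q' ⟨v, h, h'⟩ => (hF q v h).trans (hF q' v h').symm, fun e t => ?_⟩
  change F ⟨e, t⟩ = F ⟨e, G.edgeStart e⟩ + _
  simp [F, segment_zero]

theorem IsPrimitive.exists_potential {f : G.Point → ℝ} {g : G.DerivSpace}
    (h : G.IsPrimitive f g) :
    ∃ p : V → ℝ, G.coboundary p = G.increment g ∧
      (∀ e, f (G.edgePoint e (G.edgeStart e)) = p (G.source e)) := by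
  classical
  -- A vertex without edge ends carries no point of the graph, so its value `0` is arbitrary.
  let p : V → ℝ := fun v =>
    if hv : ∃ q, G.IsEndAt q v then f (Quot.mk G.Glue hv.choose) else 0
  have hp : ∀ q v, G.IsEndAt q v → f (Quot.mk G.Glue q) = p v := by
    intro q v hq
    have hv : ∃ q, G.IsEndAt q v := ⟨q, hq⟩
    simp only [p, dif_pos hv]
    exact congrArg f (Quot.sound ⟨v, hq, hv.choose_spec⟩)
  have h0 : ∀ e, f (G.edgePoint e (G.edgeStart e)) = p (G.source e) := fun e =>
    hp _ _ (Or.inl ⟨rfl, rfl⟩)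
  refine ⟨p, funext fun e => ?_, h0⟩
  have h1 : f (G.edgePoint e (G.edgeEnd e)) = p (G.target e) := hp _ _ (Or.inr ⟨rfl, rfl⟩)
  have := h e (G.edgeEnd e)
  rw [h0, h1] at this
  rw [increment_apply]
  change p (G.target e) - p (G.source e) = _
  rw [this]
  ring

theorem IsPrimitive.mem_derivs {f : G.Point → ℝ} {g : G.DerivSpace} (h : G.IsPrimitive f g) :
    g ∈ G.derivs := by
  obtain ⟨p, hp, -⟩ := h.exists_potential
  exact ⟨p, hp⟩

/-! ### Energy as an inner product, and kernels for differences of point values. -/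

variable [Fintype E]

theorem IsPrimitive.energyForm_eq {f₁ f₂ : G.Point → ℝ} {g₁ g₂ : G.DerivSpace}
    (h₁ : G.IsPrimitive f₁ g₁) (h₂ : G.IsPrimitive f₂ g₂) :
    G.energyForm f₁ f₂ = inner ℝ g₁ g₂ := by
  rw [energyForm, PiLp.inner_apply]
  refine Finset.sum_congr rfl fun e _ => ?_
  rw [L2.inner_def]
  refine integral_congr_ae ?_
  filter_upwards [h₁.weakDeriv_ae_eq e, h₂.weakDeriv_ae_eq e] with x hx1 hx2
  rw [hx1, hx2]
  simp [mul_comm]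

theorem IsPrimitive.energy_eq {f : G.Point → ℝ} {g : G.DerivSpace} (h : G.IsPrimitive f g) :
    G.energy f = ‖g‖ ^ 2 := by
  rw [energy, h.energyForm_eq h, real_inner_self_eq_norm_sq]

/-- Membership constrains only the finitely many edge increments, which depend continuously on `g`.
-/
theorem isClosed_derivs : IsClosed (G.derivs : Set G.DerivSpace) :=
  (Submodule.closed_of_finiteDimensional (LinearMap.range G.coboundary)).preimage
    G.increment.continuous

theorem exists_inner_eq_inner_apply (e : E)
    (k : Lp ℝ 2 (volume.restrict (Ioo 0 (G.length e)))) :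
    ∃ h : G.DerivSpace, ∀ g : G.DerivSpace, inner ℝ h g = inner ℝ k (g e) := by
  classical
  refine ⟨WithLp.toLp 2 (Pi.single e k), fun g => ?_⟩
  rw [PiLp.inner_apply, Finset.sum_eq_single e]
  · simp
  · intro e' _ hne
    simp [hne]
  · simp

/-- The difference is a signed sum of increments along a path from `u` to `v`. -/
theorem exists_potential_sub_eq_inner (u v : V) :
    ∃ h : G.DerivSpace, ∀ (p : V → ℝ) (g : G.DerivSpace), G.coboundary p = G.increment g →
      p v - p u = inner ℝ h g := by
  induction G.connected u v with
  | rel u v huv =>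
    obtain ⟨e, rfl, rfl⟩ := huv
    obtain ⟨h, hh⟩ := exists_inner_eq_inner_apply e (G.segment e (G.length e))
    exact ⟨h, fun p g hp => by rw [hh, ← increment_apply, ← hp]; rfl⟩
  | refl u => exact ⟨0, fun p g _ => by simp⟩
  | symm u v _ ih =>
    obtain ⟨h, hh⟩ := ih
    exact ⟨-h, fun p g hp => by rw [inner_neg_left, ← hh p g hp]; ring⟩
  | trans u v w _ _ ih₁ ih₂ =>
    obtain ⟨h₁, hh₁⟩ := ih₁
    obtain ⟨h₂, hh₂⟩ := ih₂
    exact ⟨h₁ + h₂, fun p g hp => by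
      rw [inner_add_left, ← hh₁ p g hp, ← hh₂ p g hp]; ring⟩

theorem exists_sub_eq_inner (x y : G.Point) :
    ∃ h : G.DerivSpace, ∀ (f : G.Point → ℝ) (g : G.DerivSpace), G.IsPrimitive f g →
      f x - f y = inner ℝ h g := by
  obtain ⟨⟨e, t⟩, rfl⟩ := Quot.exists_rep x
  obtain ⟨⟨e', t'⟩, rfl⟩ := Quot.exists_rep y
  obtain ⟨h₁, hh₁⟩ := exists_inner_eq_inner_apply e (G.segment e t)
  obtain ⟨h₂, hh₂⟩ := exists_inner_eq_inner_apply e' (G.segment e' t')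
  obtain ⟨h₃, hh₃⟩ := G.exists_potential_sub_eq_inner (G.source e') (G.source e)
  refine ⟨h₁ - h₂ + h₃, fun f g hf => ?_⟩
  obtain ⟨p, hp, hp0⟩ := hf.exists_potential
  change f (G.edgePoint e t) - f (G.edgePoint e' t') = _
  rw [hf e t, hf e' t', hp0, hp0, inner_add_left, inner_sub_left, hh₁, hh₂, ← hh₃ p g hp]
  ring

/-- Projecting the representing vector onto the closed subspace `derivs` makes the kernel itself the
derivative of a function on the graph. -/
theorem exists_kernel (x y : G.Point) :
    ∃ k ∈ G.derivs, ∀ (f : G.Point → ℝ) (g : G.DerivSpace), G.IsPrimitive f g →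
      inner ℝ k g = f x - f y := by
  have : CompleteSpace G.derivs := isClosed_derivs.completeSpace_coe
  obtain ⟨h, hh⟩ := exists_sub_eq_inner x y
  refine ⟨G.derivs.starProjection h, Submodule.starProjection_apply_mem _ _, fun f g hf => ?_⟩
  rw [hh f g hf, Submodule.inner_starProjection_left_eq_right,
    Submodule.starProjection_eq_self_iff.2 hf.mem_derivs]

end MetricGraph

/-! ### Maximal effective resistance and the optimal potential. -/

namespace MetricGraph

variable {V E : Type*} {G : MetricGraph V E}

theorem exists_nonconstant_isPrimitive [Nonempty E] :
    ∃ (f : G.Point → ℝ) (g : G.DerivSpace), G.IsPrimitive f g ∧ ∃ x y, f x ≠ f y := by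
  classical
  let e := Classical.arbitrary E
  have hl := G.length_pos e
  have hm : G.length e / 2 ∈ Icc 0 (G.length e) := ⟨by linarith, by linarith⟩
  have hr : G.length e ∈ Icc 0 (G.length e) := ⟨hl.le, le_rfl⟩
  -- Slope `-1` on the first half and `1` on the second: the primitive is a tent vanishing at both
  -- ends, so this works for loops too.
  let k := G.segment e (G.length e) - (2 : ℝ) • G.segment e (G.length e / 2)
  let g : G.DerivSpace := WithLp.toLp 2 (Pi.single e k)
  have hg : g ∈ G.derivs := by
    refine ⟨0, ?_⟩
    rw [map_zero]
    symm
    funext e'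
    rw [ContinuousLinearMap.coe_coe, increment_apply]
    by_cases h : e' = e
    · subst h
      simp only [g, Pi.single_eq_same, k, inner_sub_right, inner_smul_right,
        G.inner_segment_segment e hr hr, G.inner_segment_segment e hr hm]
      rw [min_self, min_eq_right hm.2]
      simp only [Pi.zero_apply]
      ring
    · simp [g, h]
  obtain ⟨f, hf⟩ := exists_isPrimitive_of_mem_derivs hg
  refine ⟨f, g, hf, G.edgePoint e ⟨_, hm⟩, G.edgePoint e (G.edgeStart e), ?_⟩
  rw [hf e ⟨_, hm⟩]
  simp only [g, Pi.single_eq_same, k, inner_sub_right, inner_smul_right,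
    G.inner_segment_segment e hm hr, G.inner_segment_segment e hm hm]
  rw [min_self, min_eq_left hm.2]
  intro h
  linarith

theorem integral_smul_coe_mul {μ : Measure G.Point} {u : Lp ℝ 2 μ} {f : G.Point → ℝ}
    (hu : u =ᵐ[μ] f) (s : ℝ) (φ : G.Point → ℝ) :
    ∫ x, (s • u : Lp ℝ 2 μ) x * φ x ∂μ = s * ∫ x, f x * φ x ∂μ := by
  rw [← integral_const_mul]
  refine integral_congr_ae ?_
  filter_upwards [hu, Lp.coeFn_smul s u] with x h1 h2
  rw [h2, Pi.smul_apply, h1, smul_eq_mul, mul_assoc]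

variable [Fintype E]

instance : CompactSpace G.Point := inferInstanceAs (CompactSpace (Quot G.Glue))

/-- A fixed base point turns the two-point kernels into differences of one map, whose continuity
suffices for compactness. -/
theorem exists_kernel_family [Nonempty E] :
    ∃ κ : G.Point → G.DerivSpace, (∀ x, κ x ∈ G.derivs) ∧
      ∀ x y (f : G.Point → ℝ) (g : G.DerivSpace), G.IsPrimitive f g →
        inner ℝ (κ x - κ y) g = f x - f y := by
  let o : G.Point := G.edgePoint _ (G.edgeStart (Classical.arbitrary E))
  choose κ hκ hκ' using fun x : G.Point => exists_kernel x o
  refine ⟨κ, hκ, fun x y f g hf => ?_⟩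
  rw [inner_sub_left, hκ' x f g hf, hκ' y f g hf]
  ring

theorem continuous_kernel_family {κ : G.Point → G.DerivSpace} (hκ : ∀ x, κ x ∈ G.derivs)
    (hκ' : ∀ x y (f : G.Point → ℝ) (g : G.DerivSpace), G.IsPrimitive f g →
      inner ℝ (κ x - κ y) g = f x - f y) : Continuous κ := by
  refine continuous_point_iff.2 fun e => ?_
  have key : ∀ s t : Icc (0 : ℝ) (G.length e),
      ‖κ (G.edgePoint e t) - κ (G.edgePoint e s)‖ ≤ √|(t : ℝ) - s| := by
    intro s t
    set k := κ (G.edgePoint e t) - κ (G.edgePoint e s) with hk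
    obtain ⟨f, hf⟩ := exists_isPrimitive_of_mem_derivs (sub_mem (hκ (G.edgePoint e t))
      (hκ (G.edgePoint e s)))
    rw [← hk] at hf
    -- The reproducing property applied to `k` itself; Cauchy-Schwarz then bounds `‖k‖` by the norm
    -- of the segment difference.
    have h1 : ‖k‖ ^ 2 = inner ℝ (G.segment e t - G.segment e s) (k e) := by
      rw [← real_inner_self_eq_norm_sq, inner_sub_left (G.segment e t)]
      have := hκ' (G.edgePoint e t) (G.edgePoint e s) f k hf
      rw [← hk] at this
      rw [this, hf e t, hf e s]
      ring
    have h2 := real_inner_le_norm (G.segment e t - G.segment e s) (k e)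
    have h3 : ‖k e‖ ≤ ‖k‖ := PiLp.norm_apply_le k e
    have h4 : ‖G.segment e t - G.segment e s‖ = √|(t : ℝ) - s| := by
      rw [← G.norm_segment_sub_sq e s.2 t.2, Real.sqrt_sq (norm_nonneg _)]
    rw [← h4]
    by_contra! hlt
    nlinarith [norm_nonneg (G.segment e t - G.segment e s), norm_nonneg (k e)]
  refine continuous_iff_continuousAt.2 fun s => ?_
  refine tendsto_iff_norm_sub_tendsto_zero.2 (squeeze_zero (fun _ => norm_nonneg _) (key s) ?_)
  have hc : Continuous fun t : Icc (0 : ℝ) (G.length e) => √|(t : ℝ) - s| := by fun_prop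
  simpa using hc.tendsto s

/-- There is a pair of points of maximal effective resistance. -/
theorem exists_maximal_kernel [Nonempty E] :
    ∃ (x y : G.Point) (k : G.DerivSpace), k ∈ G.derivs ∧ 0 < ‖k‖ ∧
      (∀ (f : G.Point → ℝ) (g : G.DerivSpace), G.IsPrimitive f g →
        inner ℝ k g = f x - f y) ∧
      ∀ (f : G.Point → ℝ) (g : G.DerivSpace), G.IsPrimitive f g →
        ∀ z w, f z - f w ≤ ‖k‖ * ‖g‖ := by
  obtain ⟨κ, hκ, hκ'⟩ := exists_kernel_family (G := G)
  have hc := continuous_kernel_family hκ hκ'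
  have : Nonempty G.Point := ⟨G.edgePoint _ (G.edgeStart (Classical.arbitrary E))⟩
  have hcp : Continuous fun p : G.Point × G.Point => ‖κ p.1 - κ p.2‖ :=
    ((hc.comp continuous_fst).sub (hc.comp continuous_snd)).norm
  obtain ⟨⟨x, y⟩, -, hmax⟩ := isCompact_univ.exists_isMaxOn univ_nonempty hcp.continuousOn
  have hmax' : ∀ z w, ‖κ z - κ w‖ ≤ ‖κ x - κ y‖ := fun z w =>
    isMaxOn_iff.1 hmax (z, w) (mem_univ _)
  refine ⟨x, y, κ x - κ y, sub_mem (hκ x) (hκ y), ?_, hκ' x y, fun f g hf z w => ?_⟩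
  -- If the maximum were zero, no function in `H¹(G)` could separate two points.
  · obtain ⟨f, g, hf, z, w, hzw⟩ := exists_nonconstant_isPrimitive (G := G)
    refine lt_of_lt_of_le (norm_pos_iff.2 fun h => hzw ?_) (hmax' z w)
    have := hκ' z w f g hf
    rw [h, inner_zero_left] at this
    linarith
  · rw [← hκ' z w f g hf]
    exact (real_inner_le_norm _ _).trans (mul_le_mul_of_nonneg_right (hmax' z w) (norm_nonneg _))

/-- The potential of the unit flow between two points of maximal effective resistance,
normalized to the range `[-1, 1]`. -/
theorem exists_optimal_potential [Nonempty E] :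
    ∃ (f : G.Point → ℝ) (x y : G.Point) (m : ℝ), G.MemH1 f ∧ f x = 1 ∧ f y = -1 ∧
      (∀ z, f z ≤ 1) ∧ (∀ z, -1 ≤ f z) ∧ 0 < m ∧
      (∀ φ, G.MemH1 φ → G.energyForm f φ = m * ((φ x - φ y) / 2)) ∧
      ∀ φ, G.MemH1 φ → ∀ z w, φ z = 1 → φ w = -1 → m ≤ G.energy φ := by
  obtain ⟨x, y, k, hkK, hpos, hk, hmax⟩ := exists_maximal_kernel (G := G)
  have hk2 : 0 < ‖k‖ ^ 2 := by positivity
  obtain ⟨F, hF⟩ := exists_isPrimitive_of_mem_derivs hkK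
  -- `F x - F y = ‖k‖ ^ 2`, so the factor `c` makes this difference `2`.
  obtain ⟨c, hcdef⟩ : ∃ c : ℝ, c = 2 / ‖k‖ ^ 2 := ⟨_, rfl⟩
  have hcpos : 0 < c := by rw [hcdef]; positivity
  have hck : c * ‖k‖ ^ 2 = 2 := by rw [hcdef]; field_simp
  have hf := (hF.smul c).add (isPrimitive_const (G := G) (1 - c * F x))
  rw [add_zero] at hf
  have hdiff : F x - F y = ‖k‖ ^ 2 := by
    rw [← hk F k hF, real_inner_self_eq_norm_sq]
  obtain ⟨f, hfdef⟩ : ∃ f : G.Point → ℝ, f = c • F + fun _ => 1 - c * F x := ⟨_, rfl⟩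
  rw [← hfdef] at hf
  have hfx : f x = 1 := by simp [hfdef]
  have hfy : f y = -1 := by
    simp only [hfdef, Pi.add_apply, Pi.smul_apply, smul_eq_mul]
    linear_combination -c * hdiff - hck
  -- Maximality of `k` bounds the oscillation by `‖k‖ * (c * ‖k‖) = 2`, already reached between `x`
  -- and `y`; hence these are extremal points of `f`.
  have hosc : ∀ z w, f z - f w ≤ 2 := by
    intro z w
    have h := hmax f _ hf z w
    rw [norm_smul, Real.norm_eq_abs, abs_of_pos hcpos] at h
    linarith [hck, (by ring : ‖k‖ * (c * ‖k‖) = c * ‖k‖ ^ 2)]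
  refine ⟨f, x, y, 2 * c, hf.memH1, hfx, hfy, fun z => ?_, fun z => ?_, by positivity,
    fun φ hφ => ?_, fun φ hφ z w hz hw => ?_⟩
  · linarith [hosc z y]
  · linarith [hosc x z]
  · obtain ⟨g, hg⟩ := hφ.exists_isPrimitive
    rw [hf.energyForm_eq hg, real_inner_smul_left, hk φ g hg]
    ring
  · obtain ⟨g, hg⟩ := hφ.exists_isPrimitive
    rw [hg.energy_eq]
    have h1 := hmax φ g hg z w
    rw [hz, hw] at h1
    have h3 : (1 - -1 : ℝ) ^ 2 ≤ (‖k‖ * ‖g‖) ^ 2 := pow_le_pow_left₀ (by norm_num) h1 2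
    rw [hcdef, ← mul_div_assoc, div_le_iff₀ hk2]
    linarith [(by ring : (‖k‖ * ‖g‖) ^ 2 = ‖g‖ ^ 2 * ‖k‖ ^ 2)]

/-! ### Comparison with the first nontrivial eigenvalue. -/

theorem memLp_of_continuous (μ : Measure G.Point) [IsFiniteMeasure μ] {f : G.Point → ℝ}
    (hf : Continuous f) : MemLp f 2 μ := by
  obtain ⟨C, hC⟩ := isCompact_univ.exists_bound_of_continuousOn hf.continuousOn
  exact MemLp.of_bound hf.aestronglyMeasurable C
    (Filter.Eventually.of_forall fun x => hC x (mem_univ x))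

theorem integrable_of_continuous (μ : Measure G.Point) [IsFiniteMeasure μ] {f : G.Point → ℝ}
    (hf : Continuous f) : Integrable f μ :=
  (memLp_of_continuous μ hf).integrable (by norm_num)

theorem memH1Measure_const (μ : Measure G.Point) (c : ℝ) : G.MemH1Measure μ fun _ => c := by
  refine ⟨(isPrimitive_const c).memH1, fun φ hφ _ => ?_⟩
  obtain ⟨g, hg⟩ := hφ.exists_isPrimitive
  rw [(isPrimitive_const c).energyForm_eq hg, inner_zero_left]

theorem le_of_two_le_rank_spectralSubspace [Nonempty E] {m : ℝ}
    (hm : ∀ φ, G.MemH1 φ → ∀ z w, φ z = 1 → φ w = -1 → m ≤ G.energy φ)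
    (μ : Measure G.Point) [IsProbabilityMeasure μ] {c : ℝ}
    (hc : 2 ≤ Module.rank ℝ (G.spectralSubspace μ c)) : m ≤ c := by
  let one : Lp ℝ 2 μ := (memLp_of_continuous μ (continuous_const (y := (1 : ℝ)))).toLp _
  have hone : one =ᵐ[μ] fun _ => (1 : ℝ) := MemLp.coeFn_toLp _
  -- The constants span at most one dimension, so some eigenvector is not constant.
  obtain ⟨u, ⟨s, hsc, f, hf, huf, hq⟩, hu⟩ :
      ∃ u ∈ {u | ∃ s ≤ c, G.LaplacianRel μ u (s • u)}, u ∉ Submodule.span ℝ {one} := by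
    by_contra! h
    have h1 : G.spectralSubspace μ c ≤ Submodule.span ℝ {one} := Submodule.span_le.2 h
    have h2 := (Submodule.rank_mono h1).trans (rank_span_le _)
    rw [Cardinal.mk_singleton] at h2
    exact absurd (hc.trans h2) (by norm_num)
  obtain ⟨g, hg⟩ := hf.1.exists_isPrimitive
  have hfc : Continuous f := hf.1.1
  have hnc : ¬ ∃ d, ∀ x, f x = d := by
    rintro ⟨d, hd⟩
    refine hu (Submodule.mem_span_singleton.2 ⟨d, Lp.ext ?_⟩)
    filter_upwards [huf, Lp.coeFn_smul d one, hone] with x h1 h2 h3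
    rw [h2, h1, Pi.smul_apply, h3, hd]
    simp
  have : Nonempty G.Point := ⟨G.edgePoint _ (G.edgeStart (Classical.arbitrary E))⟩
  have hg0 : 0 < ‖g‖ := by
    refine norm_pos_iff.2 fun h0 => hnc ⟨f (Classical.arbitrary _), fun x => ?_⟩
    obtain ⟨h, hh⟩ := exists_sub_eq_inner x (Classical.arbitrary G.Point)
    have := hh f g hg
    rw [h0, inner_zero_right] at this
    linarith
  have hff : ‖g‖ ^ 2 = s * ∫ x, f x * f x ∂μ := by
    rw [← integral_smul_coe_mul huf, ← hq f hf, ← hg.energy_eq]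
    rfl
  have hI0 : 0 ≤ ∫ x, f x * f x ∂μ := integral_nonneg fun x => mul_self_nonneg _
  have hs : 0 < s := by
    by_contra! h
    have := mul_nonpos_of_nonpos_of_nonneg h hI0
    nlinarith
  -- Testing the eigenvalue equation with `1` gives `0 = s * ∫ f`.
  have hmean : ∫ x, f x ∂μ = 0 := by
    have h1 := hq _ (memH1Measure_const μ 1)
    rw [integral_smul_coe_mul huf, hg.energyForm_eq (isPrimitive_const 1), inner_zero_right] at h1
    have := (mul_eq_zero.1 h1.symm).resolve_left hs.ne'
    simpa using this
  obtain ⟨z, -, hz⟩ := isCompact_univ.exists_isMaxOn univ_nonempty hfc.continuousOn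
  obtain ⟨w, -, hw⟩ := isCompact_univ.exists_isMinOn univ_nonempty hfc.continuousOn
  have hz' : ∀ x, f x ≤ f z := fun x => hz (mem_univ x)
  have hw' : ∀ x, f w ≤ f x := fun x => hw (mem_univ x)
  have hlt : f w < f z := by
    by_contra! h
    exact hnc ⟨f z, fun x => le_antisymm (hz' x) (h.trans (hw' x))⟩
  -- Half the oscillation and minus the midrange: `f + a` has range between `-M` and `M`, attaining
  -- both, so `M⁻¹ • (f + a)` is admissible in `hm`.
  set M := (f z - f w) / 2 with hM
  set a := -(f z + f w) / 2 with ha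
  have hMpos : 0 < M := by rw [hM]; linarith
  have hprim := (hg.add (isPrimitive_const a)).smul M⁻¹
  have hle := hm _ hprim.memH1 z w
    (by
      simp only [Pi.smul_apply, Pi.add_apply, smul_eq_mul]
      rw [inv_mul_eq_one₀ hMpos.ne', hM, ha]; ring)
    (by
      simp only [Pi.smul_apply, Pi.add_apply, smul_eq_mul]
      rw [inv_mul_eq_iff_eq_mul₀ hMpos.ne', hM, ha]; ring)
  rw [hprim.energy_eq, add_zero, norm_smul, mul_pow, hff, norm_inv, Real.norm_eq_abs,
    abs_of_pos hMpos] at hle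
  have hi1 : Integrable (fun x => f x * f x) μ := integrable_of_continuous μ (by fun_prop)
  have hi2 : Integrable (fun x => 2 * a * f x) μ := integrable_of_continuous μ (by fun_prop)
  -- With mean zero the shift can only increase the second moment.
  have hsq : ∫ x, (f x + a) ^ 2 ∂μ = (∫ x, f x * f x ∂μ) + a ^ 2 := by
    have e : ∀ x, (f x + a) ^ 2 = f x * f x + 2 * a * f x + a ^ 2 := fun x => by ring
    simp only [e]
    rw [integral_add (f := fun x => f x * f x + 2 * a * f x) (hi1.add hi2)
      (integrable_const _), integral_add hi1 hi2,
      integral_const_mul, hmean]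
    simp
  have hbd : ∫ x, (f x + a) ^ 2 ∂μ ≤ M ^ 2 := by
    calc ∫ x, (f x + a) ^ 2 ∂μ ≤ ∫ _, M ^ 2 ∂μ := by
          refine integral_mono (integrable_of_continuous μ (by fun_prop)) (integrable_const _)
            fun x => ?_
          refine sq_le_sq' ?_ ?_
          · linarith [hw' x]
          · linarith [hz' x]
      _ = M ^ 2 := by simp
  have hI : ∫ x, f x * f x ∂μ ≤ M ^ 2 := by nlinarith [sq_nonneg a]
  refine hle.trans (le_trans ?_ hsc)
  rw [inv_pow, inv_mul_le_iff₀ (by positivity)]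
  nlinarith

theorem integral_half_dirac_add_dirac (x y : G.Point) {f : G.Point → ℝ} (hf : Continuous f) :
    ∫ z, f z ∂((2 : ENNReal)⁻¹ • (Measure.dirac x + Measure.dirac y)) = (f x + f y) / 2 := by
  rw [integral_smul_measure, integral_add_measure (integrable_of_continuous _ hf)
    (integrable_of_continuous _ hf), integral_dirac' _ _ hf.stronglyMeasurable,
    integral_dirac' _ _ hf.stronglyMeasurable]
  simp
  ring

/-- The witness is half the sum of the Dirac measures at `x` and `y`, with eigenvectors `1`
(eigenvalue `0`) and `f` (eigenvalue `m`). -/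
theorem exists_two_le_rank_spectralSubspace {f : G.Point → ℝ} {x y : G.Point} {m : ℝ}
    (hf : G.MemH1 f) (hx : f x = 1) (hy : f y = -1) (hm : 0 ≤ m)
    (hq : ∀ φ, G.MemH1 φ → G.energyForm f φ = m * ((φ x - φ y) / 2)) :
    ∃ μ : Measure G.Point, IsProbabilityMeasure μ ∧
      2 ≤ Module.rank ℝ (G.spectralSubspace μ m) := by
  set μ : Measure G.Point := (2 : ENNReal)⁻¹ • (Measure.dirac x + Measure.dirac y) with hμ
  have hμp : IsProbabilityMeasure μ := ⟨by
    simp only [hμ, Measure.smul_apply, Measure.add_apply, measure_univ, smul_eq_mul]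
    rw [one_add_one_eq_two, ENNReal.inv_mul_cancel (by norm_num) (by norm_num)]⟩
  have hpos : ∀ p ∈ ({x, y} : Set G.Point), ∀ U : Set G.Point, p ∈ U → 0 < μ U := by
    intro p hp U hU
    simp only [hμ, Measure.smul_apply, Measure.add_apply, smul_eq_mul]
    refine ENNReal.mul_pos (by norm_num) ?_
    have h1 : Measure.dirac p U ≠ 0 := by
      have : (1 : ENNReal) ≤ Measure.dirac p U := by
        simpa only [indicator_of_mem hU, Pi.one_apply] using
          Measure.le_dirac_apply (a := p) (s := U)
      exact (zero_lt_one.trans_le this).ne'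
    rcases hp with rfl | rfl
    · exact fun h => h1 (add_eq_zero.1 h).1
    · exact fun h => h1 (add_eq_zero.1 h).2
  have hsupp : ∀ p ∈ ({x, y} : Set G.Point), p ∈ μ.support := fun p hp =>
    (Measure.mem_support_iff_forall p).2 fun U hU => hpos p hp U (mem_of_mem_nhds hU)
  -- The energy form against `f` sees only the values at `x` and `y`, which lie in the support.
  have hfμ : G.MemH1Measure μ f := by
    refine ⟨hf, fun φ hφ h0 => ?_⟩
    rw [hq φ hφ, h0 x (fun h => h (hsupp x (by simp))), h0 y (fun h => h (hsupp y (by simp)))]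
    simp
  let u : Lp ℝ 2 μ := (memLp_of_continuous μ hf.1).toLp f
  have hu : u =ᵐ[μ] f := MemLp.coeFn_toLp _
  let one : Lp ℝ 2 μ := (memLp_of_continuous μ (continuous_const (y := (1 : ℝ)))).toLp _
  have hone : one =ᵐ[μ] fun _ => (1 : ℝ) := MemLp.coeFn_toLp _
  have hu_mem : u ∈ G.spectralSubspace μ m := by
    -- Since `f` is `1` at `x` and `-1` at `y`, `(φ x - φ y) / 2` is the integral of `f * φ`.
    refine Submodule.subset_span ⟨m, le_rfl, f, hfμ, hu, fun φ hφ => ?_⟩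
    rw [hq φ hφ.1, integral_smul_coe_mul hu, hμ,
      integral_half_dirac_add_dirac x y (f := fun z => f z * φ z) (hf.1.mul hφ.1.1), hx, hy]
    ring
  have hone_mem : one ∈ G.spectralSubspace μ m := by
    refine Submodule.subset_span ⟨0, hm, _, memH1Measure_const μ 1, hone, fun φ hφ => ?_⟩
    obtain ⟨g, hg⟩ := hφ.1.exists_isPrimitive
    rw [integral_smul_coe_mul hone, (isPrimitive_const 1).energyForm_eq hg, inner_zero_left,
      zero_mul]
  have hli : LinearIndependent ℝ ![(⟨one, hone_mem⟩ : G.spectralSubspace μ m), ⟨u, hu_mem⟩] := by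
    rw [LinearIndependent.pair_iff]
    intro a b hab
    have hab' : a • one + b • u = 0 := congrArg Subtype.val hab
    have hae : ∀ᵐ z ∂μ, a + b * f z = 0 := by
      have h0 := Lp.coeFn_zero ℝ 2 μ
      rw [← hab'] at h0
      filter_upwards [h0, Lp.coeFn_add (a • one) (b • u), Lp.coeFn_smul a one,
        Lp.coeFn_smul b u, hone, hu] with z h1 h2 h3 h4 h5 h6
      rw [h2, Pi.add_apply, h3, h4, Pi.smul_apply, Pi.smul_apply, h5, h6] at h1
      simpa using h1
    -- Every set containing `x` or `y` has positive mass, so almost everywhere identities hold at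
    -- these two points.
    have hat : ∀ p ∈ ({x, y} : Set G.Point), a + b * f p = 0 := by
      intro p hp
      by_contra hne
      exact (hpos p hp {z | ¬ (a + b * f z = 0)} hne).ne' hae
    have h1 := hat x (by simp)
    have h2 := hat y (by simp)
    rw [hx] at h1
    rw [hy] at h2
    exact ⟨by linarith, by linarith⟩
  refine ⟨μ, hμp, ?_⟩
  simpa using hli.cardinal_lift_le_rank

end MetricGraph

/-! ### Both minima equal `m`. -/

theorem mainTheorem12 {V E : Type*} [Finite V] [Fintype E] [Nonempty E] (G : MetricGraph V E) :
    (∃ μ : Measure G.Point, IsProbabilityMeasure μ ∧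
      G.eigenvalue μ 1 = G.optimalEigenvalue 1) ∧
    IsLeast {x : EReal | ∃ f : G.Point → ℝ, G.MemH1 f ∧ IsGreatest (range f) 1 ∧
        IsLeast (range f) (-1) ∧ x = ((G.energy f : ℝ) : EReal)}
      (G.optimalEigenvalue 1) := by
  obtain ⟨f, x, y, m, hf, hx, hy, hle, hge, hm, hq, hmin⟩ :=
    MetricGraph.exists_optimal_potential (G := G)
  have hlow : ∀ μ : Measure G.Point, IsProbabilityMeasure μ → (m : EReal) ≤ G.eigenvalue μ 1 := by
    intro μ hμ
    refine le_sInf ?_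
    rintro _ ⟨c, rfl, hc⟩
    refine EReal.coe_le_coe_iff.2
      (MetricGraph.le_of_two_le_rank_spectralSubspace hmin μ ?_)
    simpa [one_add_one_eq_two] using hc
  obtain ⟨μ, hμ, hrank⟩ := MetricGraph.exists_two_le_rank_spectralSubspace hf hx hy hm.le hq
  have hμm : G.eigenvalue μ 1 = m := by
    refine le_antisymm (sInf_le ⟨m, rfl, ?_⟩) (hlow μ hμ)
    simpa [one_add_one_eq_two] using hrank
  have hopt : G.optimalEigenvalue 1 = m := by
    refine le_antisymm (sInf_le ⟨μ, hμ, hμm.symm⟩) (le_sInf ?_)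
    rintro _ ⟨ν, hν, rfl⟩
    exact hlow ν hν
  refine ⟨⟨μ, hμ, hμm.trans hopt.symm⟩, ?_, ?_⟩
  · refine ⟨f, hf, ⟨⟨x, hx⟩, ?_⟩, ⟨⟨y, hy⟩, ?_⟩, ?_⟩
    · rintro _ ⟨z, rfl⟩
      exact hle z
    · rintro _ ⟨z, rfl⟩
      exact hge z
    · rw [hopt, MetricGraph.energy, hq f hf, hx, hy]
      norm_num
  · rintro _ ⟨φ, hφ, hφ1, hφ2, rfl⟩
    obtain ⟨z, hz⟩ := hφ1.1
    obtain ⟨w, hw⟩ := hφ2.1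
    rw [hopt]
    exact EReal.coe_le_coe_iff.2 (hmin φ hφ z w hz hw)
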